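/- Consider the Heston--2CIR++ stochastic-local volatility model with parameters $S_0,v_0,g^d_0,g^f_0>0$, $k,\theta,\xi,k_d,\theta_d,\xi_d,k_f,\theta_f,\xi_f>0$, measurable leverage function $\sigma:[0,T]\times[0,\infty)\to\mathbb R$ and measurable shift functions $h_d,h_f:[0,T]\to\mathbb R$. It is driven by a four-dimensional Brownian motion $(W^s,W^v,W^d,W^f)$ on a filtered probability space, with standard components and an arbitrary constant correlation matrix with entries $\rho_{ij}$. Let $0<T<\infty$ and assume ($\mathcal A$1) there is $c\ge0$ with $0\le\sigma(t,x)\le c$ for all $t\in[0,T]$, $x\ge0$; put $\sigma_{max}=\sup\{\sigma(t,x):t\in[0,T],\,x\ge0\}$; ($\mathcal A$3) there is $h_{max}\ge0$ with $|h_d(t)|,|h_f(t)|\le h_{max}$ for all $t\in[0,T]$. For $N\in\{1,2,\dots\}$ let $\delta t=T/N$, $t_n=n\,\delta t$, $\delta W_{t_n}=W_{t_{n+1}}-W_{t_n}$ and $y^+=\max(0,y)$. The full truncation Euler / log-Euler scheme starts at $\tilde v_0=v_0$, $\tilde g^d_0=g^d_0$, $\tilde g^f_0=g^f_0$, $\bar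 x_0=\log S_0$, and, with $\bar S=e^{\bar x}$ and $\sigma_n=\sigma(t_n,\bar S_{t_n})$, $$\tilde v_{t_{n+1}}=\tilde v_{t_n}+k(\theta-\tilde v_{t_n}^+)\delta t+\xi\sqrt{\tilde v_{t_n}^+}\,\delta W^v_{t_n},\qquad \tilde g^d_{t_{n+1}}=\tilde g^d_{t_n}+k_d\big(\theta_d-(\tilde g^d_{t_n})^+\big)\delta t+\xi_d\sqrt{(\tilde g^d_{t_n})^+}\,\delta W^d_{t_n},$$ $$\tilde g^f_{t_{n+1}}=\tilde g^f_{t_n}+\Big[k_f\theta_f-k_f(\tilde g^f_{t_n})^+-\rho_{sf}\xi_f\sigma_n\sqrt{\tilde v_{t_n}^+(\tilde g^f_{t_n})^+}\Big]\delta t+\xi_f\sqrt{(\tilde g^f_{t_n})^+}\,\delta W^f_{t_n},$$ $$\bar x_{t_{n+1}}=\bar x_{t_n}+\int_{t_n}^{t_{n+1}}(h_d-h_f)(u)\,du+\Big((\tilde g^d_{t_n})^+-(\tilde g^f_{t_n})^+-\tfrac12\sigma_n^2\tilde v_{t_n}^+\Big)\delta t+\sigma_n\sqrt{\tilde v_{t_n}^+}\,\delta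 W^s_{t_n}.$$ For $u\in[t_n,t_{n+1})$ put $\bar v_u=\tilde v_{t_n}^+$, $\bar r^f_u=(\tilde g^f_{t_n})^++h_f(u)$, $\bar\sigma_u=\sigma_n$, and define the discretized discounted exchange rate $$\bar R_t=S_0\exp\Big\{-\int_0^t\bar r^f_u\,du-\frac12\int_0^t\bar\sigma_u^2\bar v_u\,du+\int_0^t\bar\sigma_u\sqrt{\bar v_u}\,dW^s_u\Big\},\qquad t\in[0,T].$$ Let $\alpha\ge1$, $\varphi(\alpha)=\alpha+\sqrt{(\alpha-1)\alpha}$, $\zeta=\xi\sigma_{max}$, and let $$T^*=\frac1{\varphi(\alpha)\zeta-k}\ \text{ if } k\le\tfrac12\varphi(\alpha)\zeta,\qquad T^*=\frac{4k}{\varphi(\alpha)^2\zeta^2}\ \text{ if } k>\tfrac12\varphi(\alpha)\zeta,$$ where $T^*=\infty$ if $\zeta=0$. If $T<T^*$, then there exists $\omega_2>\alpha$ such that, for all $\omega\in[1,\omega_2)$ and all $\delta_T<k^{-1}$, $$\sup_{\delta t\in(0,\delta_T)}\ \sup_{t\in[0,T]}\mathbb E\big[(\bar R_t)^\omega\big]<\infty,$$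 where $\delta t$ ranges over the step sizes $T/N$, $N\in\{1,2,\dots\}$. -/

import Mathlib

open MeasureTheory ProbabilityTheory
open scoped NNReal ENNReal

noncomputable section

namespace HestonSLV

/-- Parameters of the Heston--2CIR++ stochastic-local volatility model. The four Brownian drivers
are numbered `0 = s` (spot rate), `1 = v` (squared volatility), `2 = d` (domestic short rate),
`3 = f` (foreign short rate). The functions `σ t x`, `hd t`, `hf t` matter only for
`0 ≤ t ≤ T` and `0 ≤ x`. -/
structure Params where
  /-- initial spot rate, squared volatility, unshifted domestic and foreign short rates -/
  S₀ : ℝ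
  v₀ : ℝ
  gd₀ : ℝ
  gf₀ : ℝ
  /-- mean-reversion speed, long-term mean, volatility of the squared volatility -/
  k : ℝ
  θ : ℝ
  ξ : ℝ
  /-- the same for the domestic short rate -/
  kd : ℝ
  θd : ℝ
  ξd : ℝ
  /-- the same for the foreign short rate -/
  kf : ℝ
  θf : ℝ
  ξf : ℝ
  /-- leverage function `σ t x` -/
  σ : ℝ → ℝ → ℝ
  /-- deterministic shifts of the short rates -/
  hd : ℝ → ℝ
  hf : ℝ → ℝ
  /-- correlation matrix of the four Brownian drivers -/
  corr : Matrix (Fin 4) (Fin 4) ℝ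
  S₀_pos : 0 < S₀
  v₀_pos : 0 < v₀
  gd₀_pos : 0 < gd₀
  gf₀_pos : 0 < gf₀
  k_pos : 0 < k
  θ_pos : 0 < θ
  ξ_pos : 0 < ξ
  kd_pos : 0 < kd
  θd_pos : 0 < θd
  ξd_pos : 0 < ξd
  kf_pos : 0 < kf
  θf_pos : 0 < θf
  ξf_pos : 0 < ξf
  corr_posSemidef : corr.PosSemidef
  corr_diag : ∀ i, corr i i = 1

/-- `W` is a four-dimensional Brownian motion with respect to the filtration `ℱ`, with standard
components and constant correlation matrix `R`. -/
structure IsCorrelatedBrownian {Ω : Type*} {mΩ : MeasurableSpace Ω} (P : Measure Ω)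
    (ℱ : Filtration ℝ≥0 mΩ) (R : Matrix (Fin 4) (Fin 4) ℝ) (W : Fin 4 → ℝ≥0 → Ω → ℝ) : Prop where
  brownian : ∀ i, IsBrownianReal (W i) P
  adapted : ∀ i, Adapted ℱ (W i)
  /-- increments after time `s` are independent of `ℱ s` -/
  indep : ∀ s t : ℝ≥0, s ≤ t →
    Indep (ℱ s) (MeasurableSpace.comap (fun ω i => W i t ω - W i s ω) inferInstance) P
  /-- increments over `[s, t]` are centred Gaussian with covariance matrix `(t - s) R` -/
  law : ∀ s t : ℝ≥0, s ≤ t →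
    HasLaw (fun ω => WithLp.toLp 2 (fun i => W i t ω - W i s ω))
      (multivariateGaussian (0 : EuclideanSpace ℝ (Fin 4)) (((t : ℝ) - (s : ℝ)) • R)) P

/-- `0 ≤ σ(t, x) ≤ c` on `[0, T] × [0, ∞)` for some constant `c`. -/
def BoundedLeverage (m : Params) (T : ℝ) : Prop :=
  ∃ c : ℝ, 0 ≤ c ∧ ∀ t ∈ Set.Icc 0 T, ∀ x : ℝ, 0 ≤ x → 0 ≤ m.σ t x ∧ m.σ t x ≤ c

/-- Both shift functions are bounded on `[0, T]` by a common constant. -/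
def BoundedShifts (m : Params) (T : ℝ) : Prop :=
  ∃ c : ℝ, 0 ≤ c ∧ ∀ t ∈ Set.Icc 0 T, |m.hd t| ≤ c ∧ |m.hf t| ≤ c

/-- The smallest upper bound of the leverage function on `[0, T] × [0, ∞)`. -/
def sigmaMax (m : Params) (T : ℝ) : ℝ :=
  sSup {y : ℝ | ∃ t ∈ Set.Icc 0 T, ∃ x : ℝ, 0 ≤ x ∧ y = m.σ t x}

/-- `ζ = ξ σ_max`. -/
def zeta (m : Params) (T : ℝ) : ℝ := m.ξ * sigmaMax m T

/-- `φ(α) = α + √((α - 1) α)`. -/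
def phi (α : ℝ) : ℝ := α + √((α - 1) * α)

/-- The critical time `T*`, as a function of `k`, `ζ` and `α`; it is infinite if `ζ = 0`. -/
def criticalTime (k ζ α : ℝ) : ℝ≥0∞ :=
  if k ≤ 1 / 2 * phi α * ζ then ENNReal.ofReal (1 / (phi α * ζ - k))
  else ENNReal.ofReal (4 * k) / ENNReal.ofReal (phi α ^ 2 * ζ ^ 2)

/-- Values at a grid point of the auxiliary full truncation Euler processes `ṽ`, `g̃ᵈ`, `g̃ᶠ`
(which may be negative) and of the approximate log-exchange rate `x̄ = log S̄`. -/
structure State where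
  v : ℝ
  gd : ℝ
  gf : ℝ
  x : ℝ

/-- Initial state of the scheme. -/
def initState (m : Params) : State where
  v := m.v₀
  gd := m.gd₀
  gf := m.gf₀
  x := Real.log m.S₀

/-- One time step of the scheme, from the state `y` at time `r` to time `t`, with
increments `dW` of the four Brownian drivers. -/
def step (m : Params) (r t : ℝ) (y : State) (dW : Fin 4 → ℝ) : State where
  v := y.v + m.k * (m.θ - max 0 y.v) * (t - r) + m.ξ * √(max 0 y.v) * dW 1
  gd := y.gd + m.kd * (m.θd - max 0 y.gd) * (t - r) + m.ξd * √(max 0 y.gd) * dW 2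
  gf := y.gf
    + (m.kf * m.θf - m.kf * max 0 y.gf
        - m.corr 0 3 * m.ξf * m.σ r (Real.exp y.x) * √(max 0 y.v * max 0 y.gf)) * (t - r)
    + m.ξf * √(max 0 y.gf) * dW 3
  x := y.x + (∫ u in r..t, (m.hd u - m.hf u))
    + (max 0 y.gd - max 0 y.gf - 1 / 2 * m.σ r (Real.exp y.x) ^ 2 * max 0 y.v) * (t - r)
    + m.σ r (Real.exp y.x) * √(max 0 y.v) * dW 0

/-- The state of the scheme at the grid point `n δ`, driven by the path `w`. -/
def node (m : Params) (δ : ℝ) (w : Fin 4 → ℝ≥0 → ℝ) : ℕ → State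
  | 0 => initState m
  | n + 1 => step m (n * δ) ((n + 1) * δ) (node m δ w n)
      (fun i => w i (((n + 1) * δ).toNNReal) - w i ((n * δ).toNNReal))

/-- `v̄` at the grid point `n δ`. -/
def vNode (m : Params) (δ : ℝ) (w : Fin 4 → ℝ≥0 → ℝ) (n : ℕ) : ℝ := max 0 (node m δ w n).v

/-- `ḡᶠ` at the grid point `n δ`. -/
def gfNode (m : Params) (δ : ℝ) (w : Fin 4 → ℝ≥0 → ℝ) (n : ℕ) : ℝ := max 0 (node m δ w n).gf

/-- `σ(n δ, S̄)`, with `S̄` taken at the grid point `n δ`. -/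
def sigmaNode (m : Params) (δ : ℝ) (w : Fin 4 → ℝ≥0 → ℝ) (n : ℕ) : ℝ :=
  m.σ (n * δ) (Real.exp (node m δ w n).x)

/-- The index `n` of the cell `[n δ, (n + 1) δ)` that contains `u ≥ 0`. -/
def cell (δ u : ℝ) : ℕ := ⌊u / δ⌋₊

/-- The piecewise constant process `v̄`. -/
def vBar (m : Params) (δ : ℝ) (w : Fin 4 → ℝ≥0 → ℝ) (u : ℝ) : ℝ := vNode m δ w (cell δ u)

/-- The approximate foreign short rate `r̄ᶠ = ḡᶠ + hᶠ`. -/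
def rfBar (m : Params) (δ : ℝ) (w : Fin 4 → ℝ≥0 → ℝ) (u : ℝ) : ℝ :=
  gfNode m δ w (cell δ u) + m.hf u

/-- The piecewise constant process `σ̄(u, S̄_u)`. -/
def sigmaBar (m : Params) (δ : ℝ) (w : Fin 4 → ℝ≥0 → ℝ) (u : ℝ) : ℝ :=
  sigmaNode m δ w (cell δ u)

/-- Stochastic integral over `[0, t]`, against the path `b`, of the process that equals `H n`
on the cell `[n δ, (n + 1) δ)`. -/
def simpleIntegral (δ : ℝ) (H : ℕ → ℝ) (b : ℝ≥0 → ℝ) (t : ℝ) : ℝ :=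
  ∑ n ∈ Finset.range (cell δ t + 1),
    H n * (b ((min ((n + 1) * δ) t).toNNReal) - b ((n * δ).toNNReal))

/-- The discretized discounted exchange rate `R̄_t` with time step `δ`, along the path `w`. -/
def RBar (m : Params) (δ : ℝ) (w : Fin 4 → ℝ≥0 → ℝ) (t : ℝ) : ℝ :=
  m.S₀ * Real.exp (-(∫ u in (0 : ℝ)..t, rfBar m δ w u)
    - 1 / 2 * (∫ u in (0 : ℝ)..t, sigmaBar m δ w u ^ 2 * vBar m δ w u)
    + simpleIntegral δ (fun n => sigmaNode m δ w n * √(vNode m δ w n)) (w 0) t)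

end HestonSLV

end

/-! Write `R̄ = S₀ exp(-D + M - Q/2)` with `M` the stochastic integral, `Q` its quadratic variation
and `D` the integrated foreign rate. Truncation makes the rate nonnegative up to the bounded shift,
so `D` only costs a constant. By convexity, `exp(ω(M - Q/2))` is at most `exp(φM - φ²Q/2) +
exp(φ²Q/2)` with `φ = φ(ω)` (`exp_le_exp_phi_add`). The first term is a stochastic exponential, of
expectation at most one. In the second, `Q` is at most `σ_max²` times the integrated variance. Each
expectation conditions on one driver at a time.

The exponential moment of the integrated variance is controlled step by step
(`lintegral_exp_sum_vNode_le`). One Euler step turns a weight `a` on `v̄` into `a(1 - kδ) +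
a²ξ²δ/2`, up to an `O(δ)` constant due to truncation (`lintegral_exp_max_le`). The weights `M(T -
nδ)`, with `M` now a number, survive this recursion if the line `Mτ` is a supersolution of the
associated Riccati equation on `[0, T]`. Such a slope exists when `T < T*` (`exists_riccati_slope`).
The conditions are open in `ω`, so they still hold for some `ω₂ > α`. -/

namespace HestonSLV

/-! ### Conditioning on the past and Gaussian increments -/

/-- Freezing lemma: a variable independent of `𝓖` is integrated out against its law. -/
theorem lintegral_freeze {Ω E : Type*} {𝓖 mΩ : MeasurableSpace Ω} [MeasurableSpace E]
    {P : Measure Ω} [IsProbabilityMeasure P] (h𝓖 : 𝓖 ≤ mΩ)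
    {X : Ω → E} (hX : Measurable[𝓖] X) {Y : Ω → ℝ} (hY : Measurable Y)
    (hind : Indep 𝓖 (MeasurableSpace.comap Y inferInstance) P)
    {ν : Measure ℝ} (hν : P.map Y = ν) {f : E × ℝ → ℝ≥0∞} (hf : Measurable f) :
    ∫⁻ ω, f (X ω, Y ω) ∂P = ∫⁻ ω, ∫⁻ y, f (X ω, y) ∂ν ∂P := by
  have hX' : Measurable X := hX.mono h𝓖 le_rfl
  have hXY : IndepFun X Y P := by
    rw [IndepFun_iff_Indep]
    exact indep_of_indep_of_le_left hind hX.comap_le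
  have := (indepFun_iff_map_prod_eq_prod_map_map hX'.aemeasurable hY.aemeasurable).1 hXY
  subst hν
  have : IsProbabilityMeasure (P.map Y) := Measure.isProbabilityMeasure_map hY.aemeasurable
  calc ∫⁻ ω, f (X ω, Y ω) ∂P = ∫⁻ z, f z ∂(P.map fun ω => (X ω, Y ω)) :=
        (lintegral_map hf (hX'.prodMk hY)).symm
    _ = ∫⁻ x, ∫⁻ y, f (x, y) ∂(P.map Y) ∂(P.map X) := by
        rw [‹P.map _ = _›, lintegral_prod _ hf.aemeasurable]
    _ = _ := lintegral_map hf.lintegral_prod_right' hX'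

/-- Laplace transform of a centred Gaussian measure, in `ℝ≥0∞`. -/
theorem lintegral_exp_gaussianReal (c u : ℝ) (τ : ℝ≥0) :
    ∫⁻ y, ENNReal.ofReal (Real.exp (c + u * y)) ∂gaussianReal 0 τ
      = ENNReal.ofReal (Real.exp (c + u ^ 2 * τ / 2)) := by
  have h := mgf_gaussianReal (p := gaussianReal 0 τ) (X := id) (μ := 0) (v := τ) (by simp) u
  have hi := integrable_exp_mul_gaussianReal (μ := 0) (v := τ) u
  simp only [Real.exp_add]
  rw [← ofReal_integral_eq_lintegral_ofReal (hi.const_mul _) (by filter_upwards with y; positivity),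
    integral_const_mul]
  congr 2
  simp only [mgf, id] at h
  rw [h]
  ring_nf

variable {Ω : Type*} {mΩ : MeasurableSpace Ω} {P : Measure Ω} {ℱ : Filtration ℝ≥0 mΩ}
  {R : Matrix (Fin 4) (Fin 4) ℝ} {W : Fin 4 → ℝ≥0 → Ω → ℝ}

theorem IsCorrelatedBrownian.measurable (hW : IsCorrelatedBrownian P ℱ R W) (i : Fin 4) (s : ℝ≥0) :
    Measurable (W i s) := (hW.adapted i s).mono (ℱ.le s) le_rfl

theorem IsCorrelatedBrownian.map_sub (hW : IsCorrelatedBrownian P ℱ R W) (i : Fin 4)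
    {s t : ℝ≥0} (hst : s ≤ t) :
    P.map (fun ω => W i t ω - W i s ω) = gaussianReal 0 (t - s) := by
  have := (hW.brownian i).toIsPreBrownianReal.hasLaw_sub t s
  rw [show nndist t.1 s.1 = t - s from NNReal.coe_injective (by
    rw [NNReal.coe_sub hst, coe_nndist, Real.dist_eq]
    exact abs_of_nonneg (sub_nonneg.2 hst))] at this
  exact this.map_eq

theorem IsCorrelatedBrownian.indep_sub (hW : IsCorrelatedBrownian P ℱ R W) (i : Fin 4)
    {s t : ℝ≥0} (hst : s ≤ t) :
    Indep (ℱ s) (MeasurableSpace.comap (fun ω => W i t ω - W i s ω) inferInstance) P := by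
  refine indep_of_indep_of_le_right (hW.indep s t hst) ?_
  have h : (fun ω => W i t ω - W i s ω)
      = (fun x : Fin 4 → ℝ => x i) ∘ fun ω i => W i t ω - W i s ω := rfl
  rw [h, ← MeasurableSpace.comap_comp]
  exact MeasurableSpace.comap_mono (measurable_pi_apply i).comap_le

/-- Freezing lemma for Brownian increments. -/
theorem IsCorrelatedBrownian.lintegral_freeze [IsProbabilityMeasure P]
    (hW : IsCorrelatedBrownian P ℱ R W) (i : Fin 4) {s t : ℝ≥0} (hst : s ≤ t)
    {E : Type*} [MeasurableSpace E] {X : Ω → E} (hX : Measurable[ℱ s] X)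
    {f : E × ℝ → ℝ≥0∞} (hf : Measurable f) :
    ∫⁻ ω, f (X ω, W i t ω - W i s ω) ∂P
      = ∫⁻ ω, ∫⁻ y, f (X ω, y) ∂gaussianReal 0 (t - s) ∂P :=
  HestonSLV.lintegral_freeze (ℱ.le s) hX ((hW.measurable i t).sub (hW.measurable i s))
    (hW.indep_sub i hst) (hW.map_sub i hst) hf

/-- The stochastic exponential of a simple integral has expectation at most one. -/
theorem IsCorrelatedBrownian.lintegral_exp_sum_le_one [IsProbabilityMeasure P]
    (hW : IsCorrelatedBrownian P ℱ R W) (i : Fin 4) {s : ℕ → ℝ≥0} (hs : Monotone s)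
    (H : ℕ → Ω → ℝ) (n : ℕ) (hH : ∀ j < n, Measurable[ℱ (s j)] (H j)) :
    ∫⁻ ω, ENNReal.ofReal (Real.exp (∑ j ∈ Finset.range n,
      (H j ω * (W i (s (j + 1)) ω - W i (s j) ω)
        - 1 / 2 * (H j ω ^ 2 * ((s (j + 1) : ℝ) - s j))))) ∂P ≤ 1 := by
  induction n with
  | zero => simp
  | succ n ih =>
    have hle := hs n.le_succ
    set S : Ω → ℝ := fun ω => ∑ j ∈ Finset.range n,
      (H j ω * (W i (s (j + 1)) ω - W i (s j) ω)
        - 1 / 2 * (H j ω ^ 2 * ((s (j + 1) : ℝ) - s j))) with hS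
    have hSm : Measurable[ℱ (s n)] S := by
      refine Finset.measurable_sum _ fun j hj => ?_
      have hj := Finset.mem_range.1 hj
      have h1 : Measurable[ℱ (s n)] (H j) :=
        (hH j (by omega)).mono (ℱ.mono (hs hj.le)) le_rfl
      have h2 : Measurable[ℱ (s n)] (W i (s j)) :=
        (hW.adapted i (s j)).mono (ℱ.mono (hs hj.le)) le_rfl
      have h3 : Measurable[ℱ (s n)] (W i (s (j + 1))) :=
        (hW.adapted i (s (j + 1))).mono (ℱ.mono (hs hj)) le_rfl
      exact (h1.mul (h3.sub h2)).sub (((h1.pow_const 2).mul_const _).const_mul _)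
    -- Given the past at `s n`, the last increment is Gaussian with `H n` frozen; its Laplace
    -- transform cancels the compensator exactly.
    have key := hW.lintegral_freeze i hle (X := fun ω => (S ω, H n ω))
      (hSm.prodMk (hH n n.lt_succ_self))
      (f := fun z => ENNReal.ofReal (Real.exp ((z.1.1
        - 1 / 2 * (z.1.2 ^ 2 * ((s (n + 1) : ℝ) - s n))) + z.1.2 * z.2))) (by fun_prop)
    simp only [lintegral_exp_gaussianReal] at key
    calc _ = _ := lintegral_congr fun ω => ?_
      _ = _ := key
      _ = ∫⁻ ω, ENNReal.ofReal (Real.exp (S ω)) ∂P := lintegral_congr fun ω => ?_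
      _ ≤ 1 := ih fun j hj => hH j (by omega)
    · rw [Finset.sum_range_succ]
      congr 2
      simp only [hS]
      ring
    · congr 2
      simp only [NNReal.coe_sub hle]
      ring

/-! ### One Euler step of the variance -/

/-- One step of the truncated Euler scheme in the regime `1 - k δ > 0`. -/
theorem lintegral_exp_max_le {k θ ξ : ℝ} (hk : 0 < k) (hθ : 0 < θ) (hξ : 0 < ξ) {δ : ℝ≥0}
    (hδ : 0 < δ) (hkδ : k * δ < 1) {a : ℝ} (ha : 0 ≤ a) (x : ℝ) :
    ∫⁻ y, ENNReal.ofReal (Real.exp (a * max 0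
        (x + k * (θ - max 0 x) * δ + ξ * √(max 0 x) * y))) ∂gaussianReal 0 δ
      ≤ ENNReal.ofReal (Real.exp ((a * (1 - k * δ) + a ^ 2 * ξ ^ 2 * δ / 2) * max 0 x
          + (a * k * θ + a * ξ ^ 2 / (2 * (1 - k * δ))) * δ)) := by
  set v := max 0 x with hv
  have hv0 : 0 ≤ v := le_max_left _ _
  have hδ' : (0 : ℝ) < δ := by exact_mod_cast hδ
  have h1 : 0 < 1 - k * δ := by linarith
  -- The nonzero root of `-b(1 - kδ) + b²ξ²δ/2 = 0`: the expectation of `exp(-bX)` then no longer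
  -- depends on `v`, and `a / b` is of order `δ`.
  set b : ℝ := 2 * (1 - k * δ) / (ξ ^ 2 * δ) with hb
  have hb0 : 0 < b := by positivity
  set c : ℝ := v + k * (θ - v) * δ with hc
  have hsq : √v ^ 2 = v := Real.sq_sqrt hv0
  -- Truncation is paid for by `exp(a X⁺) ≤ exp(aX) + (a/b) exp(-bX)`. For `X ≤ 0` this follows from
  -- `exp u ≥ 1 + u` applied to both terms. Starting from `v` instead of `x ≤ v` only increases the
  -- left side.
  have hpt : ∀ y : ℝ, ENNReal.ofReal (Real.exp (a * max 0 (x + k * (θ - v) * δ + ξ * √v * y)))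
      ≤ ENNReal.ofReal (Real.exp (a * c + (a * ξ * √v) * y))
        + ENNReal.ofReal (a / b) * ENNReal.ofReal (Real.exp (-b * c + (-b * ξ * √v) * y)) := by
    intro y
    rw [← ENNReal.ofReal_mul (by positivity), ← ENNReal.ofReal_add (by positivity) (by positivity)]
    apply ENNReal.ofReal_le_ofReal
    set X := c + ξ * √v * y with hX
    rw [show a * c + (a * ξ * √v) * y = a * X by rw [hX]; ring,
      show -b * c + (-b * ξ * √v) * y = -b * X by rw [hX]; ring]
    have hxv : x ≤ v := le_max_right _ _
    have hle : max 0 (x + k * (θ - v) * δ + ξ * √v * y) ≤ max 0 X :=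
      max_le_max le_rfl (by rw [hX, hc]; linarith)
    refine (Real.exp_le_exp.2 (mul_le_mul_of_nonneg_left hle ha)).trans ?_
    rcases le_total 0 X with h | h
    · rw [max_eq_right h]
      have : 0 ≤ a / b * Real.exp (-b * X) := by positivity
      linarith
    · rw [max_eq_left h]
      have e1 := Real.add_one_le_exp (a * X)
      have e2 := Real.add_one_le_exp (-b * X)
      have e3 : a / b * (-b * X) ≤ a / b * Real.exp (-b * X) :=
        mul_le_mul_of_nonneg_left (by linarith) (by positivity)
      have e4 : a / b * (-b * X) = -(a * X) := by field_simp
      simp only [mul_zero, Real.exp_zero]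
      linarith
  refine (lintegral_mono hpt).trans ?_
  rw [lintegral_add_left (by fun_prop), lintegral_const_mul _ (by fun_prop),
    lintegral_exp_gaussianReal, lintegral_exp_gaussianReal,
    ← ENNReal.ofReal_mul (by positivity), ← ENNReal.ofReal_add (by positivity) (by positivity)]
  apply ENNReal.ofReal_le_ofReal
  have eA : a * c + (a * ξ * √v) ^ 2 * δ / 2
      = (a * (1 - k * δ) + a ^ 2 * ξ ^ 2 * δ / 2) * v + a * k * θ * δ := by
    rw [mul_pow, hsq, hc]; ring
  have eB : -b * c + (-b * ξ * √v) ^ 2 * δ / 2 = -b * (k * θ * δ) := by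
    rw [mul_pow, hsq, hc, hb]; field_simp; ring
  have eC : a / b = a * ξ ^ 2 / (2 * (1 - k * δ)) * δ := by
    rw [hb]; field_simp
  rw [eA, eB, eC]
  set A := (a * (1 - k * δ) + a ^ 2 * ξ ^ 2 * δ / 2) * v + a * k * θ * δ with hA
  set D := a * ξ ^ 2 / (2 * (1 - k * δ)) * δ with hD
  have hD0 : 0 ≤ D := by positivity
  have hA0 : 0 ≤ A := by positivity
  have e1 : Real.exp (-b * (k * θ * δ)) ≤ 1 := Real.exp_le_one_iff.2 (by
    have : 0 ≤ b * (k * θ * δ) := by positivity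
    linarith)
  have e2 : 1 ≤ Real.exp A := Real.one_le_exp hA0
  rw [show (a * (1 - k * δ) + a ^ 2 * ξ ^ 2 * δ / 2) * v
    + (a * k * θ + a * ξ ^ 2 / (2 * (1 - k * δ))) * δ = A + D by rw [hA, hD]; ring,
    Real.exp_add A D]
  have e3 := Real.add_one_le_exp D
  -- Since `exp A ≥ 1`, the additive error `D` becomes a factor `1 + D ≤ exp D`, which can be
  -- iterated over the steps.
  calc Real.exp A + D * Real.exp (-b * (k * θ * δ)) ≤ Real.exp A + D * Real.exp A :=
        add_le_add le_rfl (mul_le_mul_of_nonneg_left (e1.trans e2) hD0)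
    _ = Real.exp A * (D + 1) := by ring
    _ ≤ _ := by gcongr


section Leverage

variable {m : Params} {T : ℝ}

theorem BoundedLeverage.le_sigmaMax (h : BoundedLeverage m T) {t x : ℝ} (ht : t ∈ Set.Icc 0 T)
    (hx : 0 ≤ x) : m.σ t x ≤ sigmaMax m T := by
  obtain ⟨c, -, hc⟩ := h
  refine le_csSup ⟨c, ?_⟩ ⟨t, ht, x, hx, rfl⟩
  rintro y ⟨s, hs, z, hz, rfl⟩
  exact (hc s hs z hz).2

theorem BoundedLeverage.nonneg (h : BoundedLeverage m T) {t x : ℝ} (ht : t ∈ Set.Icc 0 T)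
    (hx : 0 ≤ x) : 0 ≤ m.σ t x := by
  obtain ⟨c, -, hc⟩ := h
  exact (hc t ht x hx).1

end Leverage

/-! ### Time and stochastic integrals as sums over the stopped grid -/

section Grid

theorem cell_mul_le {δ t : ℝ} (hδ : 0 < δ) (ht : 0 ≤ t) : (cell δ t : ℝ) * δ ≤ t :=
  (le_div_iff₀ hδ).1 (Nat.floor_le (by positivity))

theorem lt_cell_add_one_mul {δ : ℝ} (hδ : 0 < δ) (t : ℝ) : t < ((cell δ t : ℝ) + 1) * δ :=
  (div_lt_iff₀ hδ).1 (Nat.lt_floor_add_one _)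

theorem cell_eq {δ u : ℝ} (hδ : 0 < δ) {n : ℕ} (h1 : (n : ℝ) * δ ≤ u) (h2 : u < ((n : ℝ) + 1) * δ) :
    cell δ u = n := by
  have h0 : 0 ≤ (n : ℝ) * δ := by positivity
  exact (Nat.floor_eq_iff (div_nonneg (h0.trans h1) hδ.le)).2
    ⟨(le_div_iff₀ hδ).2 h1, (div_lt_iff₀ hδ).2 h2⟩

theorem natCast_mul_le {δ t : ℝ} (hδ : 0 < δ) (ht : 0 ≤ t) {n : ℕ}
    (hn : n < cell δ t + 1) : (n : ℝ) * δ ≤ t := by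
  have : (n : ℝ) ≤ cell δ t := by exact_mod_cast Nat.lt_succ_iff.1 hn
  exact (mul_le_mul_of_nonneg_right this hδ.le).trans (cell_mul_le hδ ht)

/-- The grid with step `δ`, stopped at `t`. -/
noncomputable def stoppedGrid (δ t : ℝ) (n : ℕ) : ℝ≥0 := (min ((n : ℝ) * δ) t).toNNReal

theorem stoppedGrid_mono {δ : ℝ} (hδ : 0 < δ) (t : ℝ) : Monotone (stoppedGrid δ t) :=
  fun i j hij => Real.toNNReal_le_toNNReal (min_le_min_right _
    (mul_le_mul_of_nonneg_right (by exact_mod_cast hij) hδ.le))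

theorem coe_stoppedGrid {δ t : ℝ} (hδ : 0 < δ) (ht : 0 ≤ t) (n : ℕ) :
    (stoppedGrid δ t n : ℝ) = min ((n : ℝ) * δ) t :=
  Real.coe_toNNReal _ (le_min (by positivity) ht)

theorem stoppedGrid_of_lt {δ t : ℝ} (hδ : 0 < δ) (ht : 0 ≤ t) {n : ℕ} (hn : n < cell δ t + 1) :
    stoppedGrid δ t n = ((n : ℝ) * δ).toNNReal := by
  rw [stoppedGrid, min_eq_left (natCast_mul_le hδ ht hn)]

/-- Only the open interval matters: the right endpoint may belong to the next cell, and the last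
interval is empty when `t` is a grid point. -/
theorem intervalIntegrable_cell {δ t : ℝ} (hδ : 0 < δ) (ht : 0 ≤ t) (H : ℕ → ℝ) (n : ℕ)
    (hn : n < cell δ t + 1) :
    IntervalIntegrable (fun u => H (cell δ u)) volume (stoppedGrid δ t n)
      (stoppedGrid δ t (n + 1)) ∧
    ∫ u in (stoppedGrid δ t n : ℝ)..stoppedGrid δ t (n + 1), H (cell δ u)
      = H n * (stoppedGrid δ t (n + 1) - stoppedGrid δ t n) := by
  have hle : (stoppedGrid δ t n : ℝ) ≤ stoppedGrid δ t (n + 1) :=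
    stoppedGrid_mono hδ t n.le_succ
  have heq : Set.EqOn (fun _ => H n) (fun u => H (cell δ u))
      (Set.Ioo (stoppedGrid δ t n : ℝ) (stoppedGrid δ t (n + 1))) := by
    intro u hu
    rw [coe_stoppedGrid hδ ht, coe_stoppedGrid hδ ht, min_eq_left (natCast_mul_le hδ ht hn)] at hu
    have h2 := hu.2.trans_le (min_le_left _ _)
    push_cast at h2
    simp only [cell_eq hδ hu.1.le h2]
  constructor
  · exact (intervalIntegrable_const (c := H n)).congr_uIoo (by rwa [Set.uIoo_of_le hle])
  · rw [← intervalIntegral.integral_congr_uIoo (by rwa [Set.uIoo_of_le hle]),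
      intervalIntegral.integral_const, smul_eq_mul, mul_comm]

theorem stoppedGrid_zero {δ t : ℝ} (ht : 0 ≤ t) : stoppedGrid δ t 0 = 0 := by
  simp [stoppedGrid, ht]

theorem coe_stoppedGrid_last {δ t : ℝ} (hδ : 0 < δ) (ht : 0 ≤ t) :
    (stoppedGrid δ t (cell δ t + 1) : ℝ) = t := by
  rw [coe_stoppedGrid hδ ht, min_eq_right]
  push_cast
  exact (lt_cell_add_one_mul hδ t).le

theorem intervalIntegrable_comp_cell {δ t : ℝ} (hδ : 0 < δ) (ht : 0 ≤ t) (H : ℕ → ℝ) :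
    IntervalIntegrable (fun u => H (cell δ u)) volume 0 t := by
  have := IntervalIntegrable.trans_iterate (a := fun n => (stoppedGrid δ t n : ℝ))
    (n := cell δ t + 1) fun k hk => (intervalIntegrable_cell hδ ht H k hk).1
  simpa only [stoppedGrid_zero ht, coe_stoppedGrid_last hδ ht, NNReal.coe_zero] using this

theorem integral_comp_cell {δ t : ℝ} (hδ : 0 < δ) (ht : 0 ≤ t) (H : ℕ → ℝ) :
    ∫ u in (0 : ℝ)..t, H (cell δ u) = ∑ n ∈ Finset.range (cell δ t + 1),
      H n * ((stoppedGrid δ t (n + 1) : ℝ) - stoppedGrid δ t n) := by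
  have := intervalIntegral.sum_integral_adjacent_intervals
    (a := fun n => (stoppedGrid δ t n : ℝ)) (μ := volume)
    (n := cell δ t + 1) fun k hk => (intervalIntegrable_cell hδ ht H k hk).1
  simp only [stoppedGrid_zero ht, coe_stoppedGrid_last hδ ht, NNReal.coe_zero] at this
  rw [← this]
  exact Finset.sum_congr rfl fun k hk =>
    (intervalIntegrable_cell hδ ht H k (Finset.mem_range.1 hk)).2

theorem simpleIntegral_eq {δ t : ℝ} (hδ : 0 < δ) (ht : 0 ≤ t) (H : ℕ → ℝ) (b : ℝ≥0 → ℝ) :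
    simpleIntegral δ H b t = ∑ n ∈ Finset.range (cell δ t + 1),
      H n * (b (stoppedGrid δ t (n + 1)) - b (stoppedGrid δ t n)) := by
  refine Finset.sum_congr rfl fun n hn => ?_
  rw [stoppedGrid_of_lt hδ ht (Finset.mem_range.1 hn), stoppedGrid]
  push_cast
  rfl

end Grid

/-! ### Adaptedness of the scheme -/

section Measurability

variable {m : Params} {T : ℝ}

/-- Measurability of the leverage function is given only on `[0, ∞)`, where the exponential takes
its values. -/
theorem measurable_sigma_exp {Ω : Type*} {𝓖 : MeasurableSpace Ω} {r : ℝ}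
    (hr : Measurable (fun x : Set.Ici (0 : ℝ) => m.σ r x)) {x : Ω → ℝ} (hx : Measurable x) :
    Measurable fun ω => m.σ r (Real.exp (x ω)) :=
  hr.comp (f := fun ω => (⟨Real.exp (x ω), (Real.exp_pos _).le⟩ : Set.Ici (0 : ℝ)))
    ((Real.measurable_exp.comp hx).subtype_mk)

/-- All components of a random state are measurable. -/
def State.Meas {Ω : Type*} (𝓖 : MeasurableSpace Ω) (y : Ω → State) : Prop :=
  Measurable (fun ω => (y ω).v) ∧ Measurable (fun ω => (y ω).gd) ∧
    Measurable (fun ω => (y ω).gf) ∧ Measurable (fun ω => (y ω).x)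

theorem State.Meas.step {Ω : Type*} {𝓖 : MeasurableSpace Ω} {r : ℝ} (t : ℝ)
    (hr : Measurable (fun x : Set.Ici (0 : ℝ) => m.σ r x)) {y : Ω → State}
    (hy : State.Meas 𝓖 y) {dW : Ω → Fin 4 → ℝ} (hW : ∀ i, Measurable fun ω => dW ω i) :
    State.Meas 𝓖 (fun ω => HestonSLV.step m r t (y ω) (dW ω)) := by
  obtain ⟨hv, hd, hf, hx⟩ := hy
  have hσ := measurable_sigma_exp hr hx
  have h0 := hW 0
  have h1 := hW 1
  have h2 := hW 2
  have h3 := hW 3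
  refine ⟨?_, ?_, ?_, ?_⟩ <;> simp only [HestonSLV.step] <;> fun_prop

variable {Ω : Type*} {mΩ : MeasurableSpace Ω} {P : Measure Ω} {ℱ : Filtration ℝ≥0 mΩ}
  {R : Matrix (Fin 4) (Fin 4) ℝ} {W : Fin 4 → ℝ≥0 → Ω → ℝ}

theorem IsCorrelatedBrownian.meas_node (hW : IsCorrelatedBrownian P ℱ R W)
    (hσ : ∀ t ∈ Set.Icc 0 T, Measurable (fun x : Set.Ici (0 : ℝ) => m.σ t x))
    {δ : ℝ} (hδ : 0 < δ) (n : ℕ) (hn : (n : ℝ) * δ ≤ T) :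
    State.Meas (ℱ ((n : ℝ) * δ).toNNReal) (fun ω => node m δ (fun i s => W i s ω) n) := by
  induction n with
  | zero => exact ⟨measurable_const, measurable_const, measurable_const, measurable_const⟩
  | succ n ih =>
    have h1 : (n : ℝ) * δ ≤ ((n + 1 : ℕ) : ℝ) * δ :=
      mul_le_mul_of_nonneg_right (by exact_mod_cast n.le_succ) hδ.le
    have hle := ℱ.mono (Real.toNNReal_le_toNNReal h1)
    obtain ⟨hv, hd, hf, hx⟩ := ih (h1.trans hn)
    refine State.Meas.step _ (hσ _ ⟨by positivity, h1.trans hn⟩)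
      ⟨hv.mono hle le_rfl, hd.mono hle le_rfl, hf.mono hle le_rfl, hx.mono hle le_rfl⟩ fun i => ?_
    have a1 := hW.adapted i (((n + 1 : ℕ) : ℝ) * δ).toNNReal
    have a2 := (hW.adapted i ((n : ℝ) * δ).toNNReal).mono hle le_rfl
    have := a1.sub a2
    push_cast at this ⊢
    exact this

end Measurability

/-! ### The critical time and the Riccati inequality -/

section CriticalTime

theorem continuous_phi : Continuous phi := by
  unfold phi
  fun_prop

/-- Below the critical time, one of two strict inequalities holds. -/
theorem lt_of_lt_criticalTime {k ζ α T : ℝ} (hk : 0 < k) (hT : 0 < T)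
    (h : ENNReal.ofReal T < criticalTime k ζ α) :
    T * (phi α * ζ) ^ 2 < 4 * k ∨
      (0 < phi α * ζ ∧ T * (phi α * ζ) < 2 ∧ T * (phi α * ζ - k) < 1) := by
  unfold criticalTime at h
  split_ifs at h with hc
  · right
    have hg : 0 < phi α * ζ := by nlinarith
    have h0 : 0 < phi α * ζ - k := by nlinarith
    rw [ENNReal.ofReal_lt_ofReal_iff (by positivity), lt_div_iff₀ h0] at h
    refine ⟨hg, ?_, h⟩
    -- In this regime `φζ ≤ 2(φζ - k)`, so the second bound follows from the third.
    nlinarith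
  · left
    rw [← mul_pow] at h
    set g := phi α * ζ
    -- For `g = 0` the critical time is infinite and the claim is just `0 < 4k`.
    rcases eq_or_ne g 0 with hg | hg
    · rw [hg]; simp [hk]
    · have hg2 : 0 < g ^ 2 := by positivity
      rw [← ENNReal.ofReal_div_of_pos hg2, ENNReal.ofReal_lt_ofReal_iff (by positivity),
        lt_div_iff₀ hg2] at h
      exact h

/-- Some `ω > α` still satisfies the inequalities of `lt_of_lt_criticalTime`. -/
theorem exists_gt_of_lt_criticalTime {k ζ α T : ℝ} (hk : 0 < k) (hT : 0 < T)
    (h : ENNReal.ofReal T < criticalTime k ζ α) :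
    ∃ ω, α < ω ∧ (T * (phi ω * ζ) ^ 2 < 4 * k ∨
      (0 < phi ω * ζ ∧ T * (phi ω * ζ) < 2 ∧ T * (phi ω * ζ - k) < 1)) := by
  have hcont := continuous_phi
  have h1 : IsOpen {ω | T * (phi ω * ζ) ^ 2 < 4 * k} := isOpen_lt (by fun_prop) (by fun_prop)
  have h2 : IsOpen {ω | 0 < phi ω * ζ} := isOpen_lt (by fun_prop) (by fun_prop)
  have h3 : IsOpen {ω | T * (phi ω * ζ) < 2} := isOpen_lt (by fun_prop) (by fun_prop)
  have h4 : IsOpen {ω | T * (phi ω * ζ - k) < 1} := isOpen_lt (by fun_prop) (by fun_prop)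
  have hmem := nhdsWithin_le_nhds (s := Set.Ioi α)
    ((h1.union (h2.inter (h3.inter h4))).mem_nhds (lt_of_lt_criticalTime hk hT h))
  obtain ⟨ω, hω, hgt⟩ := Filter.nonempty_of_mem (Filter.inter_mem hmem self_mem_nhdsWithin)
  exact ⟨ω, hgt, hω⟩

/-- A linear supersolution of the Riccati equation `y' = λ - k y + ξ² y² / 2`, `y(0) = 0`. -/
theorem exists_riccati_slope {k ξ s p T : ℝ} (hξ : 0 < ξ) (hT : 0 < T)
    (h : T * (p * (ξ * s)) ^ 2 < 4 * k ∨
      (0 < p * (ξ * s) ∧ T * (p * (ξ * s)) < 2 ∧ T * (p * (ξ * s) - k) < 1)) :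
    ∃ M, 1 / 2 * p ^ 2 * s ^ 2 ≤ M ∧ ∀ y ∈ Set.Icc 0 (M * T),
      1 / 2 * p ^ 2 * s ^ 2 - k * y + ξ ^ 2 * y ^ 2 / 2 ≤ M := by
  rcases h with h | ⟨h0, h1, h2⟩
  -- Slope `λ = p²s²/2`: it suffices that `-ky + ξ²y²/2 ≤ 0` up to `y = λT`, which is `T(pξs)² ≤
  -- 4k`.
  · refine ⟨_, le_rfl, fun y hy => ?_⟩
    have : ξ ^ 2 * y ≤ 2 * k := by
      have := mul_le_mul_of_nonneg_left hy.2 (sq_nonneg ξ)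
      nlinarith
    nlinarith [mul_nonneg hy.1 (sub_nonneg.2 this)]
  · set g := p * (ξ * s) with hg
    have hl : 1 / 2 * p ^ 2 * s ^ 2 = g ^ 2 / (2 * ξ ^ 2) := by
      rw [hg]; field_simp
    -- The slope is chosen so that the line ends at `g/ξ²`, the minimizer of `(λ - ky + ξ²y²/2)/y`,
    -- whose minimum is `g - k`. By convexity in `y` only the endpoints need checking: `y = 0` uses
    -- `Tg < 2`, the other `T(g - k) < 1`.
    have hMT : g / (ξ ^ 2 * T) * T = g / ξ ^ 2 := by field_simp
    have hle : g ^ 2 / (2 * ξ ^ 2) ≤ g / (ξ ^ 2 * T) := by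
      rw [div_le_div_iff₀ (by positivity) (by positivity)]
      have := mul_le_mul_of_nonneg_left h1.le (show 0 ≤ g * ξ ^ 2 by positivity)
      linarith
    refine ⟨g / (ξ ^ 2 * T), hl ▸ hle, fun y hy => ?_⟩
    rw [hMT] at hy
    rw [hl]
    obtain ⟨z, rfl⟩ : ∃ z, y = z * (g / ξ ^ 2) := ⟨y / (g / ξ ^ 2), by field_simp⟩
    have hp : 0 < g / ξ ^ 2 := by positivity
    have hz0 : 0 ≤ z := nonneg_of_mul_nonneg_left hy.1 hp
    have hz1 : z ≤ 1 := by
      by_contra! hc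
      nlinarith [hy.2]
    have hend : g ^ 2 / (2 * ξ ^ 2) - k * (g / ξ ^ 2) + ξ ^ 2 * (g / ξ ^ 2) ^ 2 / 2
        ≤ g / (ξ ^ 2 * T) := by
      have e : g ^ 2 / (2 * ξ ^ 2) - k * (g / ξ ^ 2) + ξ ^ 2 * (g / ξ ^ 2) ^ 2 / 2
        = T * (g - k) * (g / (ξ ^ 2 * T)) := by field_simp; ring
      rw [e]
      exact mul_le_of_le_one_left (by positivity) h2.le
    have hzz : z ^ 2 ≤ z := by nlinarith
    have hq : 0 ≤ ξ ^ 2 * (g / ξ ^ 2) ^ 2 / 2 := by positivity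
    have b1 := mul_le_mul_of_nonneg_left hend hz0
    have b2 := mul_le_mul_of_nonneg_left hle (sub_nonneg.2 hz1)
    have b3 := mul_le_mul_of_nonneg_right hzz hq
    calc _ = (1 - z) * (g ^ 2 / (2 * ξ ^ 2)) + z * (g ^ 2 / (2 * ξ ^ 2) - k * (g / ξ ^ 2))
          + z ^ 2 * (ξ ^ 2 * (g / ξ ^ 2) ^ 2 / 2) := by ring
      _ ≤ (1 - z) * (g ^ 2 / (2 * ξ ^ 2)) + z * (g ^ 2 / (2 * ξ ^ 2) - k * (g / ξ ^ 2))
          + z * (ξ ^ 2 * (g / ξ ^ 2) ^ 2 / 2) := by linarith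
      _ ≤ _ := by linarith

end CriticalTime


/-! ### Exponential moments of the integrated variance -/

variable {Ω : Type*} {mΩ : MeasurableSpace Ω} {P : Measure Ω} {ℱ : Filtration ℝ≥0 mΩ}
  {m : Params} {R : Matrix (Fin 4) (Fin 4) ℝ} {W : Fin 4 → ℝ≥0 → Ω → ℝ} {T : ℝ}

theorem vNode_nonneg (δ : ℝ) (w : Fin 4 → ℝ≥0 → ℝ) (n : ℕ) : 0 ≤ vNode m δ w n := le_max_left _ _

/-- Exponential moment of the discretized integrated variance, weighted by a linear supersolution
of the Riccati equation. -/
theorem IsCorrelatedBrownian.lintegral_exp_sum_vNode_le [IsProbabilityMeasure P]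
    (hW : IsCorrelatedBrownian P ℱ R W)
    (hσ : ∀ t ∈ Set.Icc 0 T, Measurable (fun x : Set.Ici (0 : ℝ) => m.σ t x))
    {δ δT : ℝ} (hδ : 0 < δ) (hδT : δ < δT) (hkδT : m.k * δT < 1)
    {l M : ℝ} (hM : 0 ≤ M)
    (hric : ∀ y ∈ Set.Icc 0 (M * T), l - m.k * y + m.ξ ^ 2 * y ^ 2 / 2 ≤ M)
    (n : ℕ) (hn : (n : ℝ) * δ ≤ T) :
    ∫⁻ ω, ENNReal.ofReal (Real.exp
        (l * δ * (∑ j ∈ Finset.range n, vNode m δ (fun i s => W i s ω) j)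
          + M * (T - n * δ) * vNode m δ (fun i s => W i s ω) n)) ∂P
      ≤ ENNReal.ofReal (Real.exp (M * T * m.v₀
          + M * T * (m.k * m.θ + m.ξ ^ 2 / (2 * (1 - m.k * δT))) * (n * δ))) := by
  set B := m.k * m.θ + m.ξ ^ 2 / (2 * (1 - m.k * δT)) with hB
  have hk := m.k_pos
  have hθ := m.θ_pos
  have hξ := m.ξ_pos
  have hB0 : 0 ≤ B := by
    have : 0 < 1 - m.k * δT := by linarith
    positivity
  induction n with
  | zero =>
    have : max 0 m.v₀ = m.v₀ := max_eq_right m.v₀_pos.le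
    simp [vNode, node, initState, this]
  | succ n ih =>
    have hcast : ((n + 1 : ℕ) : ℝ) * δ = n * δ + δ := by push_cast; ring
    have hn' : (n : ℝ) * δ ≤ T := by rw [hcast] at hn; linarith
    have hnn : 0 ≤ (n : ℝ) * δ := by positivity
    specialize ih hn'
    set s : ℝ≥0 := ((n : ℝ) * δ).toNNReal with hs
    set t : ℝ≥0 := (((n : ℝ) + 1) * δ).toNNReal with ht
    have hst : s ≤ t := Real.toNNReal_le_toNNReal (by linarith)
    have hδ' : t - s = δ.toNNReal := by
      apply NNReal.coe_injective
      rw [NNReal.coe_sub hst, hs, ht, Real.coe_toNNReal _ hnn, Real.coe_toNNReal _ (by positivity),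
        Real.coe_toNNReal _ hδ.le]
      ring
    have hδc : (δ.toNNReal : ℝ) = δ := Real.coe_toNNReal _ hδ.le
    set a : ℝ := M * (T - (n + 1 : ℕ) * δ) with ha
    have ha0 : 0 ≤ a := mul_nonneg hM (by linarith)
    have haM : a ≤ M * T := mul_le_mul_of_nonneg_left (by rw [hcast]; linarith) hM
    set S : Ω → ℝ := fun ω => ∑ j ∈ Finset.range (n + 1), vNode m δ (fun i s => W i s ω) j with hS
    set x : Ω → ℝ := fun ω => (node m δ (fun i s => W i s ω) n).v with hx
    have hv : ∀ j ≤ n, Measurable[ℱ s] fun ω => (node m δ (fun i s => W i s ω) j).v := by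
      intro j hj
      have hjn : (j : ℝ) * δ ≤ n * δ := mul_le_mul_of_nonneg_right (by exact_mod_cast hj) hδ.le
      exact (hW.meas_node hσ hδ j (hjn.trans hn')).1.mono
        (ℱ.mono (Real.toNNReal_le_toNNReal hjn)) le_rfl
    have hSm : Measurable[ℱ s] S := Finset.measurable_sum _ fun j hj =>
      (measurable_const (a := (0 : ℝ))).max (hv j (Nat.lt_succ_iff.1 (Finset.mem_range.1 hj)))
    have key := hW.lintegral_freeze 1 hst (X := fun ω => (S ω, x ω)) (hSm.prodMk (hv n le_rfl))
      (f := fun z => ENNReal.ofReal (Real.exp (l * δ * z.1.1)) * ENNReal.ofReal (Real.exp (a * max 0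
        (z.1.2 + m.k * (m.θ - max 0 z.1.2) * (δ.toNNReal : ℝ) + m.ξ * √(max 0 z.1.2) * z.2))))
      (by fun_prop)
    rw [hδ'] at key
    calc _ = _ := lintegral_congr fun ω => ?_
      _ = _ := key
      _ ≤ ∫⁻ ω, ENNReal.ofReal (Real.exp (M * T * B * δ)) * ENNReal.ofReal (Real.exp
          (l * δ * (∑ j ∈ Finset.range n, vNode m δ (fun i s => W i s ω) j)
          + M * (T - n * δ) * vNode m δ (fun i s => W i s ω) n)) ∂P := lintegral_mono fun ω => ?_
      _ = _ := lintegral_const_mul' _ _ ENNReal.ofReal_ne_top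
      _ ≤ _ := mul_le_mul_right ih _
      _ = _ := ?_
    · rw [← ENNReal.ofReal_mul (Real.exp_pos _).le, ← Real.exp_add]
      congr 3
      simp only [vNode, node, step, hx, hδc]
      congr 3
      ring
    · simp only
      rw [lintegral_const_mul' _ _ ENNReal.ofReal_ne_top]
      have hkδ : m.k * δ < m.k * δT := mul_lt_mul_of_pos_left hδT hk
      refine (mul_le_mul_right (lintegral_exp_max_le hk hθ hξ
        (by simpa using hδ) (by rw [hδc]; linarith) ha0 (x ω)) _).trans ?_
      rw [← ENNReal.ofReal_mul (Real.exp_pos _).le, ← ENNReal.ofReal_mul (Real.exp_pos _).le,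
        ← Real.exp_add, ← Real.exp_add, hδc]
      apply ENNReal.ofReal_le_ofReal
      apply Real.exp_le_exp.2
      have hSω : S ω = (∑ j ∈ Finset.range n, vNode m δ (fun i s => W i s ω) j) + max 0 (x ω) :=
        Finset.sum_range_succ _ _
      rw [hSω, show vNode m δ (fun i s => W i s ω) n = max 0 (x ω) from rfl,
        show M * (T - n * δ) = a + M * δ by rw [ha, hcast]; ring]
      have hv0 : 0 ≤ max 0 (x ω) := le_max_left _ _
      -- The supersolution inequality at `y = a`, times `δ v̄`, absorbs the running term `lδ` and
      -- restores the weight `a + Mδ = M(T - nδ)`.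
      have e1 := mul_le_mul_of_nonneg_right (hric a ⟨ha0, haM⟩) (mul_nonneg hδ.le hv0)
      -- Replacing `δ` by `δT` makes the error rate uniform in the step size.
      have e2 : m.ξ ^ 2 / (2 * (1 - m.k * δ)) ≤ m.ξ ^ 2 / (2 * (1 - m.k * δT)) := by
        apply div_le_div_of_nonneg_left (by positivity) <;> linarith
      have e3 : (a * m.k * m.θ + a * m.ξ ^ 2 / (2 * (1 - m.k * δ))) * δ ≤ M * T * B * δ := by
        apply mul_le_mul_of_nonneg_right _ hδ.le
        calc _ = a * (m.k * m.θ + m.ξ ^ 2 / (2 * (1 - m.k * δ))) := by ring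
          _ ≤ a * B := mul_le_mul_of_nonneg_left (by rw [hB]; linarith) ha0
          _ ≤ _ := mul_le_mul_of_nonneg_right haM hB0
      linarith
    · rw [← ENNReal.ofReal_mul (Real.exp_pos _).le, ← Real.exp_add, hcast]
      congr 2
      ring

theorem sigmaNode_sq_le (hA1 : BoundedLeverage m T) {δ : ℝ} (hδ : 0 < δ) (w : Fin 4 → ℝ≥0 → ℝ)
    {n : ℕ} (hn : (n : ℝ) * δ ≤ T) : sigmaNode m δ w n ^ 2 ≤ sigmaMax m T ^ 2 := by
  have hmem : (n : ℝ) * δ ∈ Set.Icc 0 T := ⟨by positivity, hn⟩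
  exact pow_le_pow_left₀ (hA1.nonneg hmem (Real.exp_pos _).le)
    (hA1.le_sigmaMax hmem (Real.exp_pos _).le) 2

/-- The integrated variance, weighted by the leverage function, is dominated by the exponent in
`IsCorrelatedBrownian.lintegral_exp_sum_vNode_le`. -/
theorem sum_sigmaNode_sq_mul_le (hA1 : BoundedLeverage m T) {δ t : ℝ} (hδ : 0 < δ)
    (ht : t ∈ Set.Icc 0 T) {p M : ℝ} (hM : 1 / 2 * p ^ 2 * sigmaMax m T ^ 2 ≤ M)
    (w : Fin 4 → ℝ≥0 → ℝ) :
    1 / 2 * p ^ 2 * (∑ n ∈ Finset.range (cell δ t + 1), sigmaNode m δ w n ^ 2 * vNode m δ w n *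
        ((stoppedGrid δ t (n + 1) : ℝ) - stoppedGrid δ t n))
      ≤ 1 / 2 * p ^ 2 * sigmaMax m T ^ 2 * δ * (∑ j ∈ Finset.range (cell δ t), vNode m δ w j)
        + M * (T - cell δ t * δ) * vNode m δ w (cell δ t) := by
  set l := 1 / 2 * p ^ 2 * sigmaMax m T ^ 2 with hl
  have hl0 : 0 ≤ l := by positivity
  have hterm : ∀ n < cell δ t + 1, 1 / 2 * p ^ 2 * (sigmaNode m δ w n ^ 2 * vNode m δ w n *
      ((stoppedGrid δ t (n + 1) : ℝ) - stoppedGrid δ t n))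
      ≤ l * vNode m δ w n * ((stoppedGrid δ t (n + 1) : ℝ) - stoppedGrid δ t n) := by
    intro n hn
    have h1 := sigmaNode_sq_le hA1 hδ w ((natCast_mul_le hδ ht.1 hn).trans ht.2)
    have h2 : (0 : ℝ) ≤ (stoppedGrid δ t (n + 1) : ℝ) - stoppedGrid δ t n :=
      sub_nonneg.2 (stoppedGrid_mono hδ t n.le_succ)
    have h3 : 1 / 2 * p ^ 2 * sigmaNode m δ w n ^ 2 ≤ l :=
      mul_le_mul_of_nonneg_left h1 (by positivity)
    have h4 := mul_le_mul_of_nonneg_right h3 (mul_nonneg (vNode_nonneg (m := m) δ w n) h2)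
    linarith
  rw [Finset.mul_sum, Finset.sum_range_succ, Finset.mul_sum]
  refine add_le_add (Finset.sum_le_sum fun n hn => ?_) ?_
  · have hn := Finset.mem_range.1 hn
    refine (hterm n (by omega)).trans (le_of_eq ?_)
    rw [coe_stoppedGrid hδ ht.1, coe_stoppedGrid hδ ht.1,
      min_eq_left (natCast_mul_le hδ ht.1 (n := n + 1) (by omega)),
      min_eq_left (natCast_mul_le hδ ht.1 (n := n) (by omega))]
    push_cast
    ring
  · refine (hterm _ (Nat.lt_succ_self _)).trans ?_
    rw [coe_stoppedGrid_last hδ ht.1, coe_stoppedGrid hδ ht.1, min_eq_left (cell_mul_le hδ ht.1)]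
    have h1 := cell_mul_le hδ ht.1
    have h2 := ht.2
    -- The incomplete last cell is absorbed by the terminal weight, because `l ≤ M` and `t ≤ T`.
    have h3 : l * (t - cell δ t * δ) ≤ M * (T - cell δ t * δ) :=
      mul_le_mul hM (by linarith) (by linarith) (hl0.trans hM)
    have := mul_le_mul_of_nonneg_right h3 (vNode_nonneg (m := m) δ w (cell δ t))
    linarith

/-! ### Moments of the discounted exchange rate -/

/-- `ω M - ω Q / 2` is a convex combination of `φ(ω) M - φ(ω)² Q / 2` and `φ(ω)² Q / 2`. -/
theorem exp_le_exp_phi_add {ω : ℝ} (hω : 1 ≤ ω) (M Q : ℝ) :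
    Real.exp (ω * (M - 1 / 2 * Q))
      ≤ Real.exp (phi ω * M - 1 / 2 * (phi ω ^ 2 * Q)) + Real.exp (1 / 2 * phi ω ^ 2 * Q) := by
  set r := √((ω - 1) * ω) with hr
  have hr0 : 0 ≤ r := Real.sqrt_nonneg _
  have hrsq : r ^ 2 = (ω - 1) * ω := Real.sq_sqrt (by nlinarith)
  have hphi : phi ω = ω + r := rfl
  have hp : 0 < phi ω := by rw [hphi]; linarith
  set A := phi ω * M - 1 / 2 * (phi ω ^ 2 * Q) with hA
  set B := 1 / 2 * phi ω ^ 2 * Q with hB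
  -- The weights are `ω/φ` and `r/φ`; the coefficients of `Q` agree since `φ(ω - r) = ω² - r² = ω`.
  have hconv : phi ω * (ω * (M - 1 / 2 * Q)) = ω * A + r * B := by
    rw [hA, hB]
    have : phi ω * (ω - r) = ω := by rw [hphi]; linear_combination -hrsq
    linear_combination (1 / 2 * phi ω * Q) * this
  have hmax : ω * (M - 1 / 2 * Q) ≤ max A B := by
    refine le_of_mul_le_mul_left ?_ hp
    rw [hconv, hphi, add_mul]
    exact add_le_add (mul_le_mul_of_nonneg_left (le_max_left _ _) (by linarith))
      (mul_le_mul_of_nonneg_left (le_max_right _ _) hr0)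
  refine (Real.exp_le_exp.2 hmax).trans ?_
  rcases max_choice A B with h | h <;> rw [h]
  · linarith [Real.exp_pos B]
  · linarith [Real.exp_pos A]

/-- The integrated variance in `RBar`, as a finite sum. -/
noncomputable def quadSum (m : Params) (δ : ℝ) (w : Fin 4 → ℝ≥0 → ℝ) (t : ℝ) : ℝ :=
  ∑ n ∈ Finset.range (cell δ t + 1), sigmaNode m δ w n ^ 2 * vNode m δ w n *
    ((stoppedGrid δ t (n + 1) : ℝ) - stoppedGrid δ t n)

/-- The stochastic integral in `RBar`, as a finite sum. -/
noncomputable def martSum (m : Params) (δ : ℝ) (w : Fin 4 → ℝ≥0 → ℝ) (t : ℝ) : ℝ :=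
  ∑ n ∈ Finset.range (cell δ t + 1), sigmaNode m δ w n * √(vNode m δ w n) *
    (w 0 (stoppedGrid δ t (n + 1)) - w 0 (stoppedGrid δ t n))

theorem RBar_eq {δ t : ℝ} (hδ : 0 < δ) (ht : 0 ≤ t) (hf : IntervalIntegrable m.hf volume 0 t)
    (w : Fin 4 → ℝ≥0 → ℝ) :
    RBar m δ w t = m.S₀ * Real.exp (-((∑ n ∈ Finset.range (cell δ t + 1), gfNode m δ w n *
      ((stoppedGrid δ t (n + 1) : ℝ) - stoppedGrid δ t n)) + ∫ u in (0 : ℝ)..t, m.hf u)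
      + (martSum m δ w t - 1 / 2 * quadSum m δ w t)) := by
  have h1 : ∫ u in (0 : ℝ)..t, rfBar m δ w u = (∑ n ∈ Finset.range (cell δ t + 1),
      gfNode m δ w n * ((stoppedGrid δ t (n + 1) : ℝ) - stoppedGrid δ t n))
      + ∫ u in (0 : ℝ)..t, m.hf u := by
    rw [← integral_comp_cell hδ ht]
    exact intervalIntegral.integral_add (intervalIntegrable_comp_cell hδ ht _) hf
  have h2 : ∫ u in (0 : ℝ)..t, sigmaBar m δ w u ^ 2 * vBar m δ w u = quadSum m δ w t :=
    integral_comp_cell hδ ht fun n => sigmaNode m δ w n ^ 2 * vNode m δ w n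
  rw [RBar, h1, h2, simpleIntegral_eq hδ ht, ← martSum]
  congr 2
  ring

theorem RBar_pos (δ : ℝ) (w : Fin 4 → ℝ≥0 → ℝ) (t : ℝ) : 0 < RBar m δ w t :=
  mul_pos m.S₀_pos (Real.exp_pos _)

theorem BoundedShifts.intervalIntegrable (h : BoundedShifts m T)
    (hhf : AEMeasurable m.hf (volume.restrict (Set.Icc 0 T))) {t : ℝ} (ht : t ∈ Set.Icc 0 T) :
    IntervalIntegrable m.hf volume 0 t := by
  obtain ⟨c, -, hc⟩ := h
  have hsub : Set.Ioc 0 t ⊆ Set.Icc 0 T := fun u hu => ⟨hu.1.le, hu.2.trans ht.2⟩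
  rw [intervalIntegrable_iff_integrableOn_Ioc_of_le ht.1]
  refine IntegrableOn.mono_set (t := Set.Icc 0 T) ?_ hsub
  exact Integrable.of_bound hhf.aestronglyMeasurable c
    ((ae_restrict_iff' measurableSet_Icc).2 (Filter.Eventually.of_forall fun u hu => (hc u hu).2))

theorem IsCorrelatedBrownian.measurable_RBar (hW : IsCorrelatedBrownian P ℱ R W)
    (hσ : ∀ t ∈ Set.Icc 0 T, Measurable (fun x : Set.Ici (0 : ℝ) => m.σ t x))
    {δ t : ℝ} (hδ : 0 < δ) (ht : t ∈ Set.Icc 0 T) (hf : IntervalIntegrable m.hf volume 0 t) :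
    Measurable fun ω => RBar m δ (fun i s => W i s ω) t := by
  simp only [RBar_eq hδ ht.1 hf, martSum, quadSum]
  have hn : ∀ n ∈ Finset.range (cell δ t + 1),
      State.Meas mΩ (fun ω => node m δ (fun i s => W i s ω) n) ∧
        Measurable fun ω => sigmaNode m δ (fun i s => W i s ω) n := by
    intro n hn
    have hle := (natCast_mul_le hδ ht.1 (Finset.mem_range.1 hn)).trans ht.2
    obtain ⟨hv, hd, hf, hx⟩ := hW.meas_node hσ hδ n hle
    have hF := ℱ.le ((n : ℝ) * δ).toNNReal
    exact ⟨⟨hv.mono hF le_rfl, hd.mono hF le_rfl, hf.mono hF le_rfl, hx.mono hF le_rfl⟩,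
      measurable_sigma_exp (hσ _ ⟨by positivity, hle⟩) (hx.mono hF le_rfl)⟩
  have h1 : ∀ n ∈ Finset.range (cell δ t + 1),
      Measurable fun ω => gfNode m δ (fun i s => W i s ω) n := fun n h =>
    measurable_const.max (hn n h).1.2.2.1
  have h2 : ∀ n ∈ Finset.range (cell δ t + 1),
      Measurable fun ω => vNode m δ (fun i s => W i s ω) n := fun n h =>
    measurable_const.max (hn n h).1.1
  have h3 : ∀ s, Measurable (W 0 s) := hW.measurable 0
  refine (Real.measurable_exp.comp (((Finset.measurable_fun_sum _ fun n h =>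
    (h1 n h).mul_const _).add_const _).neg.add ((Finset.measurable_fun_sum _ fun n h =>
      (((hn n h).2.mul (h2 n h).sqrt).mul ((h3 _).sub (h3 _)))).sub
        ((Finset.measurable_fun_sum _ fun n h =>
          (((hn n h).2.pow_const 2).mul (h2 n h)).mul_const _).const_mul _)))).const_mul _

/-- The truncated rate is nonnegative, so discounting by it only decreases `R̄`; the shift costs at
most `exp(ω c T)`. -/
theorem RBar_rpow_le (hA3 : BoundedShifts m T) {c : ℝ} (hc0 : 0 ≤ c)
    (hc : ∀ t ∈ Set.Icc 0 T, |m.hd t| ≤ c ∧ |m.hf t| ≤ c)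
    (hhf : AEMeasurable m.hf (volume.restrict (Set.Icc 0 T)))
    {δ t : ℝ} (hδ : 0 < δ) (ht : t ∈ Set.Icc 0 T) {ω : ℝ} (hω : 1 ≤ ω) (w : Fin 4 → ℝ≥0 → ℝ) :
    RBar m δ w t ^ ω ≤ m.S₀ ^ ω * Real.exp (ω * (c * T)) *
      (Real.exp (phi ω * martSum m δ w t - 1 / 2 * (phi ω ^ 2 * quadSum m δ w t))
        + Real.exp (1 / 2 * phi ω ^ 2 * quadSum m δ w t)) := by
  have hi := hA3.intervalIntegrable hhf ht
  rw [RBar_eq hδ ht.1 hi, Real.mul_rpow m.S₀_pos.le (Real.exp_pos _).le, ← Real.exp_mul, mul_assoc]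
  refine mul_le_mul_of_nonneg_left ?_ (Real.rpow_nonneg m.S₀_pos.le _)
  refine le_trans ?_ (mul_le_mul_of_nonneg_left (exp_le_exp_phi_add hω _ _) (Real.exp_pos _).le)
  rw [← Real.exp_add]
  apply Real.exp_le_exp.2
  have h1 : 0 ≤ ∑ n ∈ Finset.range (cell δ t + 1), gfNode m δ w n *
      ((stoppedGrid δ t (n + 1) : ℝ) - stoppedGrid δ t n) :=
    Finset.sum_nonneg fun n _ => mul_nonneg (le_max_left _ _)
      (sub_nonneg.2 (stoppedGrid_mono hδ t n.le_succ))
  have h2 : -(c * T) ≤ ∫ u in (0 : ℝ)..t, m.hf u := by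
    have := intervalIntegral.norm_integral_le_of_norm_le_const (a := 0) (b := t) (f := m.hf) (C := c)
      fun u hu => by
        rw [Set.uIoc_of_le ht.1] at hu
        exact (hc u ⟨hu.1.le, hu.2.trans ht.2⟩).2
    rw [Real.norm_eq_abs, sub_zero, abs_of_nonneg ht.1] at this
    have h3 := mul_le_mul_of_nonneg_left ht.2 hc0
    linarith [neg_abs_le (∫ u in (0 : ℝ)..t, m.hf u)]
  have := mul_le_mul_of_nonneg_left (show -((∑ n ∈ Finset.range (cell δ t + 1), gfNode m δ w n *
      ((stoppedGrid δ t (n + 1) : ℝ) - stoppedGrid δ t n)) + ∫ u in (0 : ℝ)..t, m.hf u) ≤ c * T by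
    linarith) (show 0 ≤ ω by linarith)
  linarith

/-- This is the stochastic exponential of the integrand `p σ̄ √v̄`, which is frozen at the left end
of each cell. -/
theorem IsCorrelatedBrownian.lintegral_exp_martSum_le [IsProbabilityMeasure P]
    (hW : IsCorrelatedBrownian P ℱ R W)
    (hσ : ∀ t ∈ Set.Icc 0 T, Measurable (fun x : Set.Ici (0 : ℝ) => m.σ t x))
    {δ t : ℝ} (hδ : 0 < δ) (ht : t ∈ Set.Icc 0 T) (p : ℝ) :
    ∫⁻ ω, ENNReal.ofReal (Real.exp (p * martSum m δ (fun i s => W i s ω) t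
      - 1 / 2 * (p ^ 2 * quadSum m δ (fun i s => W i s ω) t))) ∂P ≤ 1 := by
  refine le_trans (le_of_eq ?_) (hW.lintegral_exp_sum_le_one 0 (stoppedGrid_mono hδ t)
    (fun n ω => p * (sigmaNode m δ (fun i s => W i s ω) n * √(vNode m δ (fun i s => W i s ω) n)))
    (cell δ t + 1) fun n hn => ?_)
  · refine lintegral_congr fun ω => ?_
    congr 2
    rw [Finset.sum_sub_distrib, martSum, quadSum, Finset.mul_sum, Finset.mul_sum, Finset.mul_sum]
    congr 1 <;> refine Finset.sum_congr rfl fun n _ => ?_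
    · ring
    · rw [mul_pow, mul_pow, Real.sq_sqrt (vNode_nonneg _ _ _)]
      ring
  · have hle := (natCast_mul_le hδ ht.1 hn).trans ht.2
    obtain ⟨hv, -, -, hx⟩ := hW.meas_node hσ hδ n hle
    rw [stoppedGrid_of_lt hδ ht.1 hn]
    exact ((measurable_sigma_exp (hσ _ ⟨by positivity, hle⟩) hx).mul
      (measurable_const.max hv).sqrt).const_mul p

/-- The constant adds the bound `1` for the stochastic exponential to the variance moment at the
last grid point before `t`. It depends on `δT` but neither on `δ` nor on `t`. -/
theorem exists_bound_RBar_rpow [IsProbabilityMeasure P] (hW : IsCorrelatedBrownian P ℱ R W)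
    (hT : 0 < T) (hσ : ∀ t ∈ Set.Icc 0 T, Measurable (fun x : Set.Ici (0 : ℝ) => m.σ t x))
    (hhf : AEMeasurable m.hf (volume.restrict (Set.Icc 0 T)))
    (hA1 : BoundedLeverage m T) (hA3 : BoundedShifts m T) {p : ℝ} (hp : 1 ≤ p)
    (hlt : T * (phi p * zeta m T) ^ 2 < 4 * m.k ∨ (0 < phi p * zeta m T ∧
      T * (phi p * zeta m T) < 2 ∧ T * (phi p * zeta m T - m.k) < 1))
    {δT : ℝ} (hδT : m.k * δT < 1) :
    ∃ C : ℝ≥0∞, C ≠ ∞ ∧ ∀ δ, 0 < δ → δ < δT → ∀ t ∈ Set.Icc 0 T,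
      ∫⁻ ω, ENNReal.ofReal (RBar m δ (fun i s => W i s ω) t ^ p) ∂P ≤ C := by
  obtain ⟨M, hM, hric⟩ := exists_riccati_slope m.ξ_pos hT hlt
  have hM0 : 0 ≤ M := le_trans (by positivity) hM
  obtain ⟨c, hc0, hc⟩ := id hA3
  set B := m.k * m.θ + m.ξ ^ 2 / (2 * (1 - m.k * δT)) with hB
  have hB0 : 0 ≤ B := by
    have : 0 < 1 - m.k * δT := by linarith
    have := m.k_pos
    have := m.θ_pos
    positivity
  refine ⟨ENNReal.ofReal (m.S₀ ^ p * Real.exp (p * (c * T))) *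
    (1 + ENNReal.ofReal (Real.exp (M * T * m.v₀ + M * T * B * T))),
    ENNReal.mul_ne_top ENNReal.ofReal_ne_top
      (ENNReal.add_ne_top.2 ⟨ENNReal.one_ne_top, ENNReal.ofReal_ne_top⟩), fun δ hδ hδδ t ht => ?_⟩
  have hS := Real.rpow_nonneg m.S₀_pos.le p
  have hcell := (cell_mul_le hδ ht.1).trans ht.2
  calc _ ≤ ∫⁻ ω, ENNReal.ofReal (m.S₀ ^ p * Real.exp (p * (c * T))) *
        (ENNReal.ofReal (Real.exp (phi p * martSum m δ (fun i s => W i s ω) t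
          - 1 / 2 * (phi p ^ 2 * quadSum m δ (fun i s => W i s ω) t)))
        + ENNReal.ofReal (Real.exp (1 / 2 * phi p ^ 2 * sigmaMax m T ^ 2 * δ *
          (∑ j ∈ Finset.range (cell δ t), vNode m δ (fun i s => W i s ω) j)
            + M * (T - cell δ t * δ) * vNode m δ (fun i s => W i s ω) (cell δ t)))) ∂P := by
        refine lintegral_mono fun ω => ?_
        rw [← ENNReal.ofReal_add (Real.exp_pos _).le (Real.exp_pos _).le,
          ← ENNReal.ofReal_mul (by positivity)]
        refine ENNReal.ofReal_le_ofReal ((RBar_rpow_le hA3 hc0 hc hhf hδ ht hp _).trans ?_)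
        refine mul_le_mul_of_nonneg_left (add_le_add le_rfl (Real.exp_le_exp.2 ?_)) (by positivity)
        exact sum_sigmaNode_sq_mul_le hA1 hδ ht hM _
    _ ≤ _ := by
        rw [lintegral_const_mul' _ _ ENNReal.ofReal_ne_top]
        gcongr
        rw [lintegral_add_right']
        · refine add_le_add (hW.lintegral_exp_martSum_le hσ hδ ht _)
            ((hW.lintegral_exp_sum_vNode_le hσ hδ hδδ hδT hM0 hric _ hcell).trans ?_)
          refine ENNReal.ofReal_le_ofReal (Real.exp_le_exp.2 (add_le_add le_rfl ?_))
          exact mul_le_mul_of_nonneg_left hcell (by positivity)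
        · have hv : ∀ n < cell δ t + 1, Measurable fun ω => vNode m δ (fun i s => W i s ω) n :=
            fun n hn => measurable_const.max ((hW.meas_node hσ hδ n
              ((natCast_mul_le hδ ht.1 hn).trans ht.2)).1.mono (ℱ.le _) le_rfl)
          have h1 : Measurable fun ω => ∑ j ∈ Finset.range (cell δ t),
              vNode m δ (fun i s => W i s ω) j := Finset.measurable_fun_sum _ fun n hn =>
            hv n (Nat.lt_succ_of_lt (Finset.mem_range.1 hn))
          have h2 := hv _ (Nat.lt_succ_self (cell δ t))
          exact Measurable.aemeasurable (by fun_prop)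

end HestonSLV


/-! ### From the exponent `ω₂` to all smaller exponents -/

theorem proposition3p4p4 {Ω : Type*} {mΩ : MeasurableSpace Ω} (P : Measure Ω)
    [IsProbabilityMeasure P] (ℱ : Filtration ℝ≥0 mΩ) (m : HestonSLV.Params)
    (W : Fin 4 → ℝ≥0 → Ω → ℝ) (hW : HestonSLV.IsCorrelatedBrownian P ℱ m.corr W)
    (T : ℝ) (hT : 0 < T)
    (hσ_meas : ∀ t ∈ Set.Icc 0 T, Measurable (fun x : Set.Ici (0 : ℝ) => m.σ t x))
    (hhd_meas : AEMeasurable m.hd (volume.restrict (Set.Icc 0 T)))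
    (hhf_meas : AEMeasurable m.hf (volume.restrict (Set.Icc 0 T)))
    (hA1 : HestonSLV.BoundedLeverage m T) (hA3 : HestonSLV.BoundedShifts m T)
    (α : ℝ) (hα : 1 ≤ α)
    (hTstar : ENNReal.ofReal T < HestonSLV.criticalTime m.k (HestonSLV.zeta m T) α) :
    ∃ ω₂ : ℝ, α < ω₂ ∧ ∀ ω ∈ Set.Ico 1 ω₂, ∀ δT : ℝ, δT < m.k⁻¹ →
      ∃ C : ℝ, ∀ N : ℕ, 0 < N → T / N < δT → ∀ t ∈ Set.Icc 0 T,
        Integrable (fun x => HestonSLV.RBar m (T / N) (fun i s => W i s x) t ^ ω) P ∧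
          ∫ x, HestonSLV.RBar m (T / N) (fun i s => W i s x) t ^ ω ∂P ≤ C := by
  obtain ⟨ω₂, hαω, hlt⟩ := HestonSLV.exists_gt_of_lt_criticalTime m.k_pos hT hTstar
  refine ⟨ω₂, hαω, fun ω hω δT hδT => ?_⟩
  have hkδ : m.k * δT < 1 := by
    have := mul_lt_mul_of_pos_left hδT m.k_pos
    rwa [mul_inv_cancel₀ m.k_pos.ne'] at this
  obtain ⟨C, hC, hbound⟩ := HestonSLV.exists_bound_RBar_rpow hW hT hσ_meas hhf_meas hA1 hA3
    (hα.trans hαω.le) hlt hkδ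
  have hC' : 1 + C ≠ ∞ := ENNReal.add_ne_top.2 ⟨ENNReal.one_ne_top, hC⟩
  refine ⟨(1 + C).toReal, fun N hN hNδ t ht => ?_⟩
  have hδ : 0 < T / N := div_pos hT (by exact_mod_cast hN)
  set X : Ω → ℝ := fun x => HestonSLV.RBar m (T / N) (fun i s => W i s x) t with hX
  have hXpos : ∀ x, 0 < X x := fun x => HestonSLV.RBar_pos _ _ _
  have hXm : Measurable X :=
    hW.measurable_RBar hσ_meas hδ ht (hA3.intervalIntegrable hhf_meas ht)
  have hnn : ∀ x, 0 ≤ X x ^ ω := fun x => (Real.rpow_pos_of_pos (hXpos x) _).le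
  -- Only `ω₂` needs the estimate: `X ^ ω ≤ 1 + X ^ ω₂` for `ω < ω₂`. The finite bound also yields
  -- integrability.
  have hle : ∫⁻ x, ENNReal.ofReal (X x ^ ω) ∂P ≤ 1 + C := by
    calc _ ≤ ∫⁻ x, (1 + ENNReal.ofReal (X x ^ ω₂)) ∂P := by
          refine lintegral_mono fun x => ?_
          rw [← ENNReal.ofReal_one, ← ENNReal.ofReal_add zero_le_one
            (Real.rpow_pos_of_pos (hXpos x) _).le]
          apply ENNReal.ofReal_le_ofReal
          rcases le_total (X x) 1 with h | h
          · linarith [Real.rpow_le_one (hXpos x).le h (by linarith [hω.1] : 0 ≤ ω),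
              Real.rpow_pos_of_pos (hXpos x) ω₂]
          · linarith [Real.rpow_le_rpow_of_exponent_le h hω.2.le]
      _ ≤ _ := by
          rw [lintegral_add_left measurable_const]
          simpa using hbound _ hδ hNδ t ht
  have hint : Integrable (fun x => X x ^ ω) P := by
    refine ⟨(hXm.pow_const ω).aestronglyMeasurable, ?_⟩
    rw [hasFiniteIntegral_iff_ofReal (Filter.Eventually.of_forall hnn)]
    exact hle.trans_lt hC'.lt_top
  refine ⟨hint, ?_⟩
  rw [integral_eq_lintegral_of_nonneg_ae (Filter.Eventually.of_forall hnn) hint.1]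
  exact ENNReal.toReal_mono hC' hle
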